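/- Let $F$ be a free group (of arbitrary, possibly infinite, rank) and let $H$ and $K$ be subgroups of $F$ of rank $2$. Write $H\vee K=\langle H,K\rangle$ for the join of $H$ and $K$, and write $\mathrm{rank}(G)$ for the minimal number of generators of a finitely generated group $G$ (for a free group $G$ this is the cardinality of a basis). Then $H\cap K$ and $H\vee K$ are finitely generated, and $$\mathrm{rank}(H\cap K)\ \le\ 4-\mathrm{rank}(H\vee K).$$ In particular, if $\mathrm{rank}(H\cap K)=2$, then $\mathrm{rank}(H\vee K)=2$. -/

import Mathlib

/-!
A free group `G` is bi-orderable, by means of the Magnus representation, so its group ring embeds in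
the division ring `D` of Mal'cev–Neumann series. Assume that `G` is the join of `H` and `K`, and let
`b` be a basis of `H ⊓ K`. Expand each `b i - 1` in terms of the generators of `H`, and again in
terms of those of `K`. By the fundamental formula of the Fox calculus, the difference of the two
expansions is a vector in the kernel of a surjection `D ^ (rank H + rank K) → D ^ rank G`.

Any three of these vectors are linearly independent. Indeed, the truncation of a relation among
coefficients supported in a subgroup `S`, which retains the terms over `S`, is again a relation.
Hence a shortest relation, normalised to have a coefficient `1`, has all of its coefficients
supported in `S`. Moreover, no nontrivial relation among the expansions with respect to one system
of generators has coefficients supported in `H ⊓ K`. The elements `b i - 1` are nonzero and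
supported in `H ⊓ K`, so a nontrivial relation among the expansions over `H`, or over `K`, has at
least three terms. A common relation with three terms is then shortest in both systems, so its
normalisation is supported in `H` and in `K`, hence in `H ⊓ K`, a contradiction.

Comparing dimensions, `min 3 (rank (H ⊓ K)) + rank G ≤ rank H + rank K`.
-/

section OrderedGroup

variable {G : Type*} [Group G] [PartialOrder G] [MulLeftMono G] [MulRightMono G] {s t : Set G}

open scoped Pointwise in
theorem isPWO_mul (hs : s.IsPWO) (ht : t.IsPWO) : (s * t).IsPWO := by
  rw [← Set.image_mul_prod]
  exact (hs.prod ht).image_of_monotone fun _ _ h => mul_le_mul' h.1 h.2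

theorem finite_mulAntidiagonal_of_isPWO (hs : s.IsPWO) (ht : t.IsPWO) (z : G) :
    (Set.mulAntidiagonal s t z).Finite := by
  refine IsAntichain.finite_of_partiallyWellOrderedOn (r := (· ≤ ·)) ?_
    ((hs.prod ht).mono fun p hp => ⟨hp.1, hp.2.1⟩)
  intro p hp q hq hne hle
  have h := (mul_eq_mul_iff_eq_and_eq hle.1 hle.2).1 (hp.2.2.trans hq.2.2.symm)
  exact hne (Prod.ext h.1 h.2)

theorem isPWO_submonoid_closure (hs : s.IsPWO) (h1 : ∀ x ∈ s, 1 ≤ x) :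
    (Submonoid.closure s : Set G).IsPWO := by
  rw [Submonoid.closure_eq_image_prod]
  refine (Set.PartiallyWellOrderedOn.partiallyWellOrderedOn_sublistForall₂ (· ≤ ·)
    hs).image_of_monotone_on ?_
  exact fun _ _ l hl h => h.prod_le_prod' fun x hx => h1 x (hl x hx)

end OrderedGroup

/-- The **Mal'cev–Neumann series** over a bi-ordered group `G`. These are the Hahn series, with
the convolution product, which needs no commutativity of `G`. -/
abbrev MalcevNeumann (k G : Type*) [Zero k] [PartialOrder G] : Type _ := HahnSeries G k

namespace MalcevNeumann

section Ring

variable {k G : Type*} [Ring k] [Group G] [PartialOrder G]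

noncomputable instance : One (MalcevNeumann k G) := ⟨HahnSeries.single 1 1⟩

theorem one_def : (1 : MalcevNeumann k G) = HahnSeries.single 1 1 := rfl

open scoped Pointwise in
theorem support_convolution_subset (f g : MalcevNeumann k G) :
    (Function.support fun z => ∑ᶠ x, f.coeff x * g.coeff (x⁻¹ * z)) ⊆ f.support * g.support := by
  intro z hz
  obtain ⟨x, hx⟩ : ∃ x, f.coeff x * g.coeff (x⁻¹ * z) ≠ 0 := by
    by_contra! h
    exact hz (finsum_eq_zero_of_forall_eq_zero h)
  exact ⟨x, left_ne_zero_of_mul hx, x⁻¹ * z, right_ne_zero_of_mul hx, mul_inv_cancel_left x z⟩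

variable [MulLeftMono G] [MulRightMono G]

theorem finite_support_mul (f g : MalcevNeumann k G) (z : G) :
    (fun x => f.coeff x * g.coeff (x⁻¹ * z)).HasFiniteSupport := by
  refine ((finite_mulAntidiagonal_of_isPWO f.isPWO_support g.isPWO_support z).image
    Prod.fst).subset fun x hx => ⟨(x, x⁻¹ * z), ⟨?_, ?_, mul_inv_cancel_left x z⟩, rfl⟩
  · exact left_ne_zero_of_mul hx
  · exact right_ne_zero_of_mul hx

noncomputable instance : Mul (MalcevNeumann k G) where
  mul f g :=
    { coeff z := ∑ᶠ x, f.coeff x * g.coeff (x⁻¹ * z)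
      isPWO_support' := (isPWO_mul f.isPWO_support g.isPWO_support).mono
        (support_convolution_subset f g) }

theorem coeff_mul (f g : MalcevNeumann k G) (z : G) :
    (f * g).coeff z = ∑ᶠ x, f.coeff x * g.coeff (x⁻¹ * z) := rfl

open scoped Pointwise in
theorem support_mul_subset (f g : MalcevNeumann k G) :
    (f * g).support ⊆ f.support * g.support := support_convolution_subset f g

theorem coeff_mul' (f g : MalcevNeumann k G) (z : G) :
    (f * g).coeff z = ∑ᶠ y, f.coeff (z * y⁻¹) * g.coeff y := by
  rw [coeff_mul, ← finsum_comp_equiv ((Equiv.inv G).trans (Equiv.mulLeft z))]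
  simp

theorem coeff_single_mul (x : G) (c : k) (f : MalcevNeumann k G) (z : G) :
    (HahnSeries.single x c * f : MalcevNeumann k G).coeff z = c * f.coeff (x⁻¹ * z) := by
  rw [coeff_mul, finsum_eq_single _ x fun y hy => by
    rw [HahnSeries.coeff_single_of_ne hy, zero_mul], HahnSeries.coeff_single_same]

theorem coeff_mul_single (x : G) (c : k) (f : MalcevNeumann k G) (z : G) :
    (f * HahnSeries.single x c : MalcevNeumann k G).coeff z = f.coeff (z * x⁻¹) * c := by
  rw [coeff_mul', finsum_eq_single _ x fun y hy => by
    rw [HahnSeries.coeff_single_of_ne hy, mul_zero], HahnSeries.coeff_single_same]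

theorem single_mul_single (x y : G) (c d : k) :
    (HahnSeries.single x c * HahnSeries.single y d : MalcevNeumann k G) =
      HahnSeries.single (x * y) (c * d) := by
  ext z
  rw [coeff_single_mul]
  by_cases hz : z = x * y
  · rw [hz, inv_mul_cancel_left, HahnSeries.coeff_single_same, HahnSeries.coeff_single_same]
  · rw [HahnSeries.coeff_single_of_ne hz, HahnSeries.coeff_single_of_ne fun h => hz
      (inv_mul_eq_iff_eq_mul.1 h), mul_zero]

theorem finite_support_mul_mul (f g h : MalcevNeumann k G) (z : G) :
    (fun p : G × G =>
      f.coeff p.1 * g.coeff (p.1⁻¹ * p.2) * h.coeff (p.2⁻¹ * z)).HasFiniteSupport := by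
  have hY := (finite_mulAntidiagonal_of_isPWO (isPWO_mul f.isPWO_support g.isPWO_support)
    h.isPWO_support z).image Prod.fst
  refine (hY.biUnion fun y _ => (finite_support_mul f g y).image fun x => (x, y)).subset ?_
  rintro ⟨x, y⟩ hxy
  have hfg := left_ne_zero_of_mul hxy
  refine Set.mem_biUnion ⟨(y, y⁻¹ * z), ⟨?_, right_ne_zero_of_mul hxy, mul_inv_cancel_left y z⟩,
    rfl⟩ ⟨x, hfg, rfl⟩
  exact ⟨x, left_ne_zero_of_mul hfg, x⁻¹ * y, right_ne_zero_of_mul hfg, mul_inv_cancel_left x y⟩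

protected theorem mul_assoc (f g h : MalcevNeumann k G) : f * g * h = f * (g * h) := by
  ext z
  have hfin := finite_support_mul_mul f g h z
  calc (f * g * h).coeff z
      = ∑ᶠ y, ∑ᶠ x, f.coeff x * g.coeff (x⁻¹ * y) * h.coeff (y⁻¹ * z) :=
        finsum_congr fun y => finsum_mul' _ _ (finite_support_mul f g y)
    _ = ∑ᶠ x, ∑ᶠ y, f.coeff x * g.coeff (x⁻¹ * y) * h.coeff (y⁻¹ * z) := by
        rw [← finsum_curry (fun p : G × G => _) hfin, ← finsum_comp_equiv (Equiv.prodComm G G)]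
        exact (finsum_curry _ (hfin.preimage (Equiv.prodComm G G).injective.injOn)).symm
    _ = ∑ᶠ x, ∑ᶠ y, f.coeff x * (g.coeff y * h.coeff (y⁻¹ * (x⁻¹ * z))) := by
        refine finsum_congr fun x => ?_
        rw [← finsum_comp_equiv (Equiv.mulLeft x)]
        simp [mul_assoc]
    _ = (f * (g * h)).coeff z :=
        finsum_congr fun x => (mul_finsum' _ _ (finite_support_mul g h (x⁻¹ * z))).symm

noncomputable instance : Ring (MalcevNeumann k G) where
  __ := (inferInstance : AddCommGroup (HahnSeries G k))
  mul_assoc := MalcevNeumann.mul_assoc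
  one_mul f := by ext z; simp [one_def, coeff_single_mul]
  mul_one f := by ext z; simp [one_def, coeff_mul_single]
  zero_mul f := by ext z; simp [coeff_mul]
  mul_zero f := by ext z; simp [coeff_mul]
  left_distrib f g h := by
    ext z
    simp only [coeff_mul, HahnSeries.coeff_add, mul_add]
    exact finsum_add_distrib (finite_support_mul f g z) (finite_support_mul f h z)
  right_distrib f g h := by
    ext z
    simp only [coeff_mul, HahnSeries.coeff_add, add_mul]
    exact finsum_add_distrib (finite_support_mul f h z) (finite_support_mul g h z)

variable (k) in
/-- The embedding of the group `G` in the multiplicative monoid of the series over `G`. -/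
noncomputable def of : G →* MalcevNeumann k G where
  toFun x := HahnSeries.single x 1
  map_one' := rfl
  map_mul' x y := by rw [single_mul_single, one_mul]

theorem of_apply (x : G) : of k x = HahnSeries.single x 1 := rfl

theorem of_injective [Nontrivial k] : Function.Injective (of k : G →* MalcevNeumann k G) := by
  intro x y h
  refine HahnSeries.eq_of_mem_support_single (r := (1 : k)) ?_
  rw [← of_apply, ← h, of_apply, HahnSeries.support_single_of_ne one_ne_zero, Set.mem_singleton_iff]

end Ring

section DivisionRing

variable {k G : Type*}

section Neumann

variable [Ring k] [Group G] [LinearOrder G] [MulLeftMono G] [MulRightMono G]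

theorem coeff_mul_eq_finsum_lt {g f : MalcevNeumann k G} {M : Submonoid G}
    (hg : ∀ x ∈ g.support, 1 < x) (hf : f.support ⊆ M) (z : M) :
    (g * f).coeff z =
      ∑ᶠ y : {y : M // (y : G) < z}, g.coeff (z * (y : G)⁻¹) * f.coeff (y : G) := by
  rw [coeff_mul', ← finsum_mem_univ fun y => g.coeff (z * y⁻¹) * f.coeff y,
    ← finsum_mem_range (f := fun y => g.coeff (z * y⁻¹) * f.coeff y)
      (g := fun y : {y : M // (y : G) < z} => (y : G))
      (Subtype.val_injective.comp Subtype.val_injective)]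
  refine finsum_mem_inter_support_eq' _ _ _ fun y hy => iff_of_true (Set.mem_univ y) ?_
  have hyz : y < z := by simpa using mul_lt_mul_left (hg _ (left_ne_zero_of_mul hy)) y
  exact ⟨⟨⟨y, hf (right_ne_zero_of_mul hy)⟩, hyz⟩, rfl⟩

theorem exists_eq_one_add_mul (g : MalcevNeumann k G) (hg : ∀ x ∈ g.support, 1 < x) :
    ∃ h : MalcevNeumann k G, h = 1 + g * h := by
  let M := Submonoid.closure g.support
  have hM : (M : Set G).IsPWO := isPWO_submonoid_closure g.isPWO_support fun x hx => (hg x hx).le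
  have wf : WellFounded fun y z : M => (y : G) < z := hM.isWF
  -- the equation determines `h z` from the values `h y` with `y < z`
  let h : M → k := wf.fix fun z rec =>
    (1 : MalcevNeumann k G).coeff z +
      ∑ᶠ y : {y : M // (y : G) < z}, g.coeff (z * (y : G)⁻¹) * rec y y.2
  have hh (z : M) : h z = (1 : MalcevNeumann k G).coeff z +
      ∑ᶠ y : {y : M // (y : G) < z}, g.coeff (z * (y : G)⁻¹) * h y := wf.fix_eq _ z
  have hsupp : Function.support (Function.extend Subtype.val h 0) ⊆ (M : Set G) := fun z hz => by
    by_contra hzM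
    exact hz (Function.extend_apply' _ _ _ fun ⟨y, hy⟩ => hzM (hy ▸ y.2))
  let H : MalcevNeumann k G := ⟨Function.extend Subtype.val h 0, hM.mono hsupp⟩
  have H_coe (z : M) : H.coeff z = h z := Subtype.val_injective.extend_apply _ _ z
  refine ⟨H, HahnSeries.ext (funext fun z => ?_)⟩
  rw [HahnSeries.coeff_add]
  by_cases hz : z ∈ M
  · lift z to M using hz
    rw [H_coe, hh, coeff_mul_eq_finsum_lt hg hsupp]
    simp only [H_coe]
  · have hz1 : z ≠ 1 := fun h => hz (h ▸ M.one_mem)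
    have hgH : (g * H).coeff z = 0 := by
      by_contra h
      obtain ⟨x, hx, y, hy, rfl⟩ := support_mul_subset g H h
      exact hz (M.mul_mem (Submonoid.subset_closure hx) (hsupp hy))
    rw [hgH, one_def, HahnSeries.coeff_single_of_ne hz1, zero_add]
    exact not_imp_comm.1 (@hsupp z) hz

end Neumann

variable [DivisionRing k] [Group G] [LinearOrder G] [MulLeftMono G] [MulRightMono G]

theorem exists_mul_eq_one {f : MalcevNeumann k G} (hf : f ≠ 0) : ∃ h, f * h = 1 := by
  have hne := HahnSeries.support_nonempty_iff.2 hf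
  set x := f.isPWO_support.isWF.min hne
  have hx : f.coeff x ≠ 0 := Set.IsWF.min_mem _ hne
  let u : MalcevNeumann k G := HahnSeries.single x (f.coeff x)
  let v : MalcevNeumann k G := HahnSeries.single x⁻¹ (f.coeff x)⁻¹
  have huv : u * v = 1 := by
    rw [single_mul_single, mul_inv_cancel, mul_inv_cancel₀ hx, one_def]
  obtain ⟨h, hh⟩ := exists_eq_one_add_mul (1 - v * f) fun y hy => by
    rw [HahnSeries.mem_support, HahnSeries.coeff_sub, coeff_single_mul, inv_inv] at hy
    rcases lt_trichotomy y 1 with hlt | rfl | hgt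
    · rw [one_def, HahnSeries.coeff_single_of_ne hlt.ne, zero_sub, neg_ne_zero] at hy
      exact absurd (mul_lt_of_lt_one_right' x hlt)
        (Set.IsWF.not_lt_min _ hne (right_ne_zero_of_mul hy))
    · rw [one_def, HahnSeries.coeff_single_same, mul_one, inv_mul_cancel₀ hx, sub_self] at hy
      exact absurd rfl hy
    · exact hgt
  have hvfh : v * f * h = 1 := by
    rw [sub_mul, one_mul, ← add_sub_assoc, eq_sub_iff_add_eq, add_comm 1 h] at hh
    exact add_left_cancel hh
  refine ⟨h * v, ?_⟩
  calc f * (h * v) = u * v * (f * (h * v)) := by rw [huv, one_mul]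
    _ = u * (v * f * h) * v := by simp only [mul_assoc]
    _ = 1 := by rw [hvfh, mul_one, huv]

/-- The **Mal'cev–Neumann theorem**. -/
noncomputable instance : DivisionRing (MalcevNeumann k G) :=
  DivisionRing.ofIsUnitOrEqZero fun f => by
    refine or_iff_not_imp_right.2 fun hf => ?_
    obtain ⟨h, hh⟩ := exists_mul_eq_one hf
    obtain ⟨f', hf'⟩ := exists_mul_eq_one (right_ne_zero_of_mul_eq_one hh)
    exact ⟨⟨f, h, hh, left_inv_eq_right_inv hh hf' ▸ hf'⟩, rfl⟩

end DivisionRing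

section Support

variable {k G : Type*} [Ring k] [Group G] [PartialOrder G]

/-- The truncation of a series to a subgroup `S`, which retains the coefficients over `S`. -/
noncomputable def proj (S : Subgroup G) : MalcevNeumann k G →+ MalcevNeumann k G where
  toFun f := ⟨(S : Set G).indicator f.coeff, f.isPWO_support.mono fun _ hx h =>
    hx (Set.indicator_apply_eq_zero.2 fun _ => h)⟩
  map_zero' := by ext; simp
  map_add' f g := HahnSeries.ext (Set.indicator_add _ _ _)

theorem coeff_proj (S : Subgroup G) (f : MalcevNeumann k G) :
    (proj S f).coeff = (S : Set G).indicator f.coeff := rfl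

variable [MulLeftMono G] [MulRightMono G]

variable (k) in
/-- The subring of the series supported in a subgroup `S`. -/
def supported (S : Subgroup G) : Subring (MalcevNeumann k G) where
  carrier := {f | f.support ⊆ S}
  zero_mem' := by simp
  one_mem' := HahnSeries.support_single_subset.trans (Set.singleton_subset_iff.2 S.one_mem)
  add_mem' hf hg := (HahnSeries.support_add_subset _ _).trans (Set.union_subset hf hg)
  neg_mem' hf := by simpa using hf
  mul_mem' {f g} hf hg := by
    refine (support_mul_subset f g).trans ?_
    rintro _ ⟨x, hx, y, hy, rfl⟩
    exact S.mul_mem (hf hx) (hg hy)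

variable {S T : Subgroup G} {f u : MalcevNeumann k G} {x : G}

theorem mem_supported : f ∈ supported k S ↔ f.support ⊆ S := Iff.rfl

theorem coeff_eq_zero_of_mem_supported (hf : f ∈ supported k S) (hx : x ∉ S) : f.coeff x = 0 :=
  not_imp_comm.1 (@hf x) hx

theorem of_mem_supported (hx : x ∈ S) : of k x ∈ supported k S :=
  HahnSeries.support_single_subset.trans (Set.singleton_subset_iff.2 hx)

theorem mem_supported_inf (hS : f ∈ supported k S) (hT : f ∈ supported k T) :
    f ∈ supported k (S ⊓ T) := Set.subset_inter hS hT

theorem proj_eq_self_iff : proj S f = f ↔ f ∈ supported k S := by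
  rw [mem_supported, HahnSeries.ext_iff, coeff_proj, Set.indicator_eq_self]
  rfl

theorem proj_mul_left (hu : u ∈ supported k S) (f : MalcevNeumann k G) :
    proj S (u * f) = u * proj S f := by
  ext z
  have key (x : G) : u.coeff x * (proj S f).coeff (x⁻¹ * z) =
      (S : Set G).indicator (fun z => u.coeff x * f.coeff (x⁻¹ * z)) z := by
    by_cases hx : x ∈ S
    · have hmem : x⁻¹ * z ∈ S ↔ z ∈ S := S.mul_mem_cancel_left (S.inv_mem hx)
      by_cases hz : z ∈ S <;> simp [coeff_proj, hmem, hz]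
    · simp [coeff_eq_zero_of_mem_supported hu hx]
  rw [coeff_mul, finsum_congr key, coeff_proj]
  by_cases hz : z ∈ S <;> simp [hz, coeff_mul]

theorem proj_mul_right (hu : u ∈ supported k S) (f : MalcevNeumann k G) :
    proj S (f * u) = proj S f * u := by
  ext z
  have key (y : G) : (proj S f).coeff (z * y⁻¹) * u.coeff y =
      (S : Set G).indicator (fun z => f.coeff (z * y⁻¹) * u.coeff y) z := by
    by_cases hy : y ∈ S
    · have hmem : z * y⁻¹ ∈ S ↔ z ∈ S := S.mul_mem_cancel_right (S.inv_mem hy)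
      by_cases hz : z ∈ S <;> simp [coeff_proj, hmem, hz]
    · simp [coeff_eq_zero_of_mem_supported hu hy]
  rw [coeff_mul', finsum_congr key, coeff_proj]
  by_cases hz : z ∈ S <;> simp [hz, coeff_mul']

theorem proj_of_of_mem (hx : x ∈ S) : proj S (of k x) = of k x :=
  proj_eq_self_iff.2 (of_mem_supported hx)

theorem proj_of_of_notMem (hx : x ∉ S) : proj S (of k x) = 0 := by
  ext y
  refine Set.indicator_apply_eq_zero.2 fun hy => HahnSeries.coeff_single_of_ne ?_
  exact ne_of_mem_of_not_mem hy hx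

theorem proj_one (S : Subgroup G) : proj S (1 : MalcevNeumann k G) = 1 :=
  proj_of_of_mem S.one_mem

end Support

end MalcevNeumann

section PolynomialOrder

open Polynomial

variable {R : Type*} [Ring R]

theorem coeff_mul_left_of_forall_lt {u p : R[X]} {n : ℕ} (hu : u.coeff 0 = 1)
    (hp : ∀ i < n, p.coeff i = 0) : ∀ i ≤ n, (u * p).coeff i = p.coeff i := by
  obtain ⟨v, hv⟩ : X ∣ u - 1 := X_dvd_iff.2 (by simp [hu])
  obtain ⟨q, hq⟩ := X_pow_dvd_iff.2 hp
  have h : X ^ (n + 1) ∣ u * p - p := ⟨v * q, by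
    rw [← sub_one_mul, hv, hq, X_mul, mul_assoc, ← mul_assoc X, ← pow_succ', ← mul_assoc,
      ← X_pow_mul, mul_assoc]⟩
  intro i hi
  rw [← sub_eq_zero, ← coeff_sub]
  exact X_pow_dvd_iff.1 h i (Nat.lt_succ_of_le hi)

theorem coeff_mul_right_of_forall_lt {u p : R[X]} {n : ℕ} (hu : u.coeff 0 = 1)
    (hp : ∀ i < n, p.coeff i = 0) : ∀ i ≤ n, (p * u).coeff i = p.coeff i := by
  obtain ⟨v, hv⟩ : X ∣ u - 1 := X_dvd_iff.2 (by simp [hu])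
  obtain ⟨q, hq⟩ := X_pow_dvd_iff.2 hp
  have h : X ^ (n + 1) ∣ p * u - p := ⟨q * v, by
    rw [← mul_sub_one, hv, hq, X_mul, ← mul_assoc, ← X_mul, mul_assoc (X ^ n), ← mul_assoc X,
      ← pow_succ']⟩
  intro i hi
  rw [← sub_eq_zero, ← coeff_sub]
  exact X_pow_dvd_iff.1 h i (Nat.lt_succ_of_le hi)

theorem exists_biOrder_of_injective_polynomial {G Γ : Type*} [Group G] [AddCommGroup Γ]
    [LinearOrder Γ] [IsOrderedAddMonoid Γ] {f : R →+ Γ} (hf : Function.Injective f)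
    {m : G →* R[X]} (hm : Function.Injective m) (hm1 : ∀ g, (m g).coeff 0 = 1) :
    ∃ _ : LinearOrder G, MulLeftMono G ∧ MulRightMono G := by
  let e (g : G) : Lex (ℕ → Γ) := toLex fun n => f ((m g).coeff n)
  have he : Function.Injective e := fun g h hgh =>
    hm (Polynomial.ext fun n => hf (congrFun (toLex_inj.1 hgh) n))
  have e_lt {a b a' b' : G} (h : e a < e b)
      (hab : ∀ n, (∀ i < n, (m b - m a).coeff i = 0) →
        ∀ i ≤ n, (m b' - m a').coeff i = (m b - m a).coeff i) : e a' < e b' := by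
    obtain ⟨n, hlt, hn⟩ := h
    have hba : ∀ i < n, (m b - m a).coeff i = 0 := fun i hi => by
      rw [coeff_sub, sub_eq_zero]
      exact (hf (hlt i hi)).symm
    have key := hab n hba
    refine ⟨n, fun i hi => ?_, ?_⟩
    · have := (key i hi.le).trans (hba i hi)
      rw [coeff_sub, sub_eq_zero] at this
      exact congrArg f this.symm
    · have hpos : 0 < f ((m b - m a).coeff n) := by
        rw [coeff_sub, map_sub]; exact sub_pos.2 hn
      rw [← key n le_rfl, coeff_sub, map_sub] at hpos
      exact sub_pos.1 hpos
  let : LinearOrder G := LinearOrder.lift' e he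
  refine ⟨inferInstance, ⟨fun c a b h => ?_⟩, ⟨fun c a b h => ?_⟩⟩
  · rcases h.eq_or_lt with rfl | h
    · exact le_rfl
    · exact (e_lt h fun n hn => by
        rw [map_mul, map_mul, ← mul_sub]
        exact coeff_mul_left_of_forall_lt (hm1 c) hn).le
  · rcases h.eq_or_lt with rfl | h
    · exact le_rfl
    · exact (e_lt h fun n hn => by
        simp only [map_mul, ← sub_mul]
        exact coeff_mul_right_of_forall_lt (hm1 c) hn).le

end PolynomialOrder

namespace Magnus

open Polynomial Monoid

variable {α : Type*}

open scoped Classical in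
/-- The operator that prepends the letter `i` to the words that do not begin with `i` and kills the
others. In contrast to the variables of the ring of formal power series, these operators square to
zero, whence `(1 + shift i * X) ^ e = 1 + e * shift i * X`. -/
noncomputable def shift (i : α) : Module.End ℤ (List α →₀ ℤ) :=
  Finsupp.linearCombination ℤ fun w => if w.head? = some i then 0 else Finsupp.single (i :: w) 1

theorem shift_single_of_head?_ne {i : α} {w : List α} (hw : w.head? ≠ some i) (c : ℤ) :
    shift i (Finsupp.single w c) = Finsupp.single (i :: w) c := by
  simp [shift, hw]

theorem shift_mul_shift (i : α) : shift i * shift i = 0 := by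
  ext1 w
  ext1
  by_cases hw : w.head? = some i <;> simp [shift, hw]

theorem prod_smul_shift_apply (l : List (α × ℤ)) (hl : l.IsChain fun p q => p.1 ≠ q.1) :
    (l.map fun p => p.2 • shift p.1).prod (Finsupp.single [] 1) =
      Finsupp.single (l.map Prod.fst) (l.map Prod.snd).prod := by
  induction l with
  | nil => rfl
  | cons p l ih =>
    have hp : (l.map Prod.fst).head? ≠ some p.1 := by
      cases l with
      | nil => simp
      | cons q l => simpa using hl.rel.symm
    rw [List.map_cons, List.prod_cons, Module.End.mul_apply, ih hl.tail, LinearMap.smul_apply,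
      shift_single_of_head?_ne hp, Finsupp.smul_single, smul_eq_mul]
    rfl

/-- The homomorphism whose values are the powers of the unit `1 + shift i * X`. -/
noncomputable def linearHom (i : α) :
    Multiplicative ℤ →* (Module.End ℤ (List α →₀ ℤ))[X] where
  toFun e := 1 + C (e.toAdd • shift i) * X
  map_one' := by simp
  map_mul' d e := by
    have h : C (d.toAdd • shift i) * X * (C (e.toAdd • shift i) * X) = 0 := by
      rw [mul_assoc, ← mul_assoc X, X_mul, ← mul_assoc, ← mul_assoc, ← C_mul, smul_mul_smul_comm,
        shift_mul_shift, smul_zero, C_0, zero_mul, zero_mul]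
    rw [toAdd_mul, add_smul, C_add, add_mul, mul_add, add_mul, add_mul, h, one_mul, one_mul,
      mul_one, add_zero]
    abel

/-- The exponent of an element of the infinite cyclic group `FreeGroup Unit`. -/
def exponent : FreeGroup Unit →* Multiplicative ℤ := FreeGroup.lift fun _ => Multiplicative.ofAdd 1

theorem toAdd_exponent_ne_zero {m : FreeGroup Unit} (hm : m ≠ 1) : (exponent m).toAdd ≠ 0 := by
  obtain ⟨n, rfl⟩ := FreeGroup.freeGroupUnitEquivInt.symm.surjective m
  change FreeGroup.of () ^ n ≠ 1 at hm
  have hn : n ≠ 0 := fun h => hm (by rw [h, zpow_zero])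
  simpa [exponent, FreeGroup.freeGroupUnitEquivInt] using hn

variable (α) in
/-- A variant of the Magnus representation of the free group, regarded here as a free product of
infinite cyclic groups. -/
noncomputable def hom : CoprodI (fun _ : α => FreeGroup Unit) →* (Module.End ℤ (List α →₀ ℤ))[X] :=
  CoprodI.lift fun i => (linearHom i).comp exponent

theorem coeff_zero_hom (g : CoprodI fun _ : α => FreeGroup Unit) : (hom α g).coeff 0 = 1 := by
  induction g using CoprodI.induction_on with
  | one => simp
  | of i m => simp [hom, linearHom]
  | mul g h hg hh => rw [map_mul, mul_coeff_zero, hg, hh, one_mul]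

theorem coeff_length_hom_prod (w : CoprodI.Word fun _ : α => FreeGroup Unit) :
    (hom α w.prod).coeff w.toList.length (Finsupp.single [] 1) =
      Finsupp.single (w.toList.map Sigma.fst)
        (w.toList.map fun s => (exponent s.2).toAdd).prod := by
  let l := w.toList.map fun s => (s.1, (exponent s.2).toAdd)
  let factors := l.map fun p => 1 + C (p.2 • shift p.1) * X
  have hprod : hom α w.prod = factors.prod := by
    simp [CoprodI.Word.prod, hom, linearHom, factors, l, map_list_prod, Function.comp_def]
  have hdeg : ∀ p ∈ factors, natDegree p ≤ 1 := by
    simp only [factors, List.forall_mem_map]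
    intro p _
    compute_degree
  have hcoeff : factors.map (fun p => p.coeff 1) = l.map fun p => p.2 • shift p.1 := by
    simp only [factors, List.map_map, Function.comp_def, coeff_add, coeff_one, coeff_C_mul,
      coeff_X_one, one_ne_zero, if_false, zero_add, mul_one]
  have hlength : factors.length * 1 = w.toList.length := by simp [factors, l]
  rw [hprod, ← hlength, coeff_list_prod_of_natDegree_le _ 1 hdeg, hcoeff,
    prod_smul_shift_apply l ((List.isChain_map _).2 w.chain_ne), List.map_map, List.map_map]
  rfl

theorem hom_injective : Function.Injective (hom α) := by
  classical
  refine (injective_iff_map_eq_one _).2 fun g hg => ?_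
  obtain ⟨w, rfl⟩ := CoprodI.Word.equiv.symm.surjective g
  change hom α w.prod = 1 at hg
  change w.prod = 1
  by_contra hw
  have hne : w.toList ≠ [] := fun h => hw (by simp [CoprodI.Word.prod, h])
  have h := coeff_length_hom_prod w
  rw [hg, coeff_one, if_neg (by simpa using hne), LinearMap.zero_apply, eq_comm,
    Finsupp.single_eq_zero, List.prod_eq_zero_iff, List.mem_map] at h
  obtain ⟨s, hs, hs0⟩ := h
  exact toAdd_exponent_ne_zero (w.ne_one s hs) hs0

end Magnus

theorem exists_biOrder_of_isFreeGroup (G : Type*) [Group G] [IsFreeGroup G] :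
    ∃ _ : LinearOrder G, MulLeftMono G ∧ MulRightMono G := by
  let α := IsFreeGroup.Generators G
  obtain ⟨_, _⟩ := exists_wellFoundedLT (List α × List α)
  let matrix : Module.End ℤ (List α →₀ ℤ) →+ Lex (List α × List α → ℤ) :=
    { toFun a := toLex fun p => a (Finsupp.single p.1 1) p.2
      map_zero' := rfl
      map_add' _ _ := rfl }
  have hmatrix : Function.Injective matrix := fun a b hab => by
    ext v w
    exact congrFun (toLex_inj.1 hab) (v, w)
  let e := (IsFreeGroup.toFreeGroup G).trans freeGroupEquivCoprodI
  exact exists_biOrder_of_injective_polynomial hmatrix (m := (Magnus.hom α).comp e.toMonoidHom)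
    (Magnus.hom_injective.comp e.injective) fun g => Magnus.coeff_zero_hom (e g)

section CrossedHom

variable {G A V : Type*} [Group G] [Ring A] [AddCommGroup V] [Module A V]

/-- `d` is a crossed homomorphism, or derivation, from `G` to the module `V`, on which `G` acts
through `e`. -/
def IsCrossedHom (e : G →* A) (d : G → V) : Prop :=
  ∀ x y, d (x * y) = d x + e x • d y

theorem IsCrossedHom.map_one {e : G →* A} {d : G → V} (hd : IsCrossedHom e d) : d 1 = 0 := by
  simpa using hd 1 1

theorem exists_isCrossedHom_basis {ι : Type*} (b : FreeGroupBasis ι G) (e : G →* A) (v : ι → V) :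
    ∃ d : G → V, IsCrossedHom e d ∧ ∀ i, d (b i) = v i := by
  -- `x ↦ (w ↦ e x • w + d x)` is to be a homomorphism to the group of affine automorphisms of `V`
  let lin : G →* V ≃ₗ[ℤ] V := (DistribMulAction.toModuleAut ℤ V).comp e.toHomUnits
  let aff : G →* V ≃ᵃ[ℤ] V :=
    b.lift fun i => (lin (b i)).toAffineEquiv.trans (AffineEquiv.constVAdd ℤ V (v i))
  have aff_basis (i : ι) :
      aff (b i) = (lin (b i)).toAffineEquiv.trans (AffineEquiv.constVAdd ℤ V (v i)) := by
    simp [aff]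
  have linear_aff : AffineEquiv.linearHom.comp aff = lin := b.ext_hom _ _ fun i => by
    rw [MonoidHom.comp_apply, aff_basis]
    rfl
  refine ⟨fun x => aff x 0, fun x y => ?_, fun i => by simp [aff_basis]⟩
  have h := (aff x).map_vadd 0 (aff y 0)
  rw [show (aff x).linear = lin x from DFunLike.congr_fun linear_aff x] at h
  simp only [vadd_eq_add, add_zero] at h
  change aff (x * y) 0 = aff x 0 + lin x (aff y 0)
  rw [map_mul, add_comm, ← h]
  rfl

end CrossedHom

section RightCosets

variable {G : Type*} [Group G] {L : Subgroup G}

/-- The type of right cosets `L * x` of a subgroup. -/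
abbrev RightCosets (L : Subgroup G) : Type _ := Quotient (QuotientGroup.rightRel L)

/-- The right coset of `x`. -/
abbrev RightCosets.mk (L : Subgroup G) (x : G) : RightCosets L := Quotient.mk _ x

namespace RightCosets

theorem mk_eq_mk_iff {x y : G} : mk L x = mk L y ↔ y * x⁻¹ ∈ L :=
  Quotient.eq.trans QuotientGroup.rightRel_apply

theorem mul_out_inv_mem (x : G) : x * (mk L x).out⁻¹ ∈ L :=
  mk_eq_mk_iff.1 (mk L x).out_eq

end RightCosets

theorem exists_equivariant_retraction (L : Subgroup G) :
    ∃ ρ : G → L, (∀ (l : L) (x : G), ρ (l * x) = l * ρ x) ∧ ρ 1 = 1 := by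
  have mk_mul (l : L) (x : G) : RightCosets.mk L (l * x) = RightCosets.mk L x :=
    RightCosets.mk_eq_mk_iff.2 (by simp)
  let ρ (x : G) : L := ⟨x * (RightCosets.mk L x).out⁻¹, RightCosets.mul_out_inv_mem x⟩
  refine ⟨fun x => ρ x * (ρ 1)⁻¹, fun l x => ?_, mul_inv_cancel _⟩
  ext
  simp [ρ, mk_mul, mul_assoc]

end RightCosets

section GroupRing

open MonoidAlgebra (of lift)

variable {G V : Type*} [Group G] [AddCommGroup V]

/-- The additive extension of a function on `G` to the group ring. -/
noncomputable def extend (g : G → V) : MonoidAlgebra ℤ G →ₗ[ℤ] V :=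
  (MonoidAlgebra.basis G ℤ).constr ℤ g

theorem extend_of (g : G → V) (x : G) : extend g (of ℤ G x) = g x :=
  (MonoidAlgebra.basis G ℤ).constr_basis ℤ g x

theorem groupRing_hom_ext {f g : MonoidAlgebra ℤ G →ₗ[ℤ] V}
    (h : ∀ x, f (of ℤ G x) = g (of ℤ G x)) : f = g :=
  (MonoidAlgebra.basis G ℤ).ext h

theorem extend_mul_of_sub_one (g : G → V) (p : MonoidAlgebra ℤ G) (a : G) :
    extend g (p * (of ℤ G a - 1)) = extend (fun y => g (y * a) - g y) p := by
  suffices h : extend g ∘ₗ LinearMap.mulRight ℤ (of ℤ G a - 1) =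
      extend fun y => g (y * a) - g y from LinearMap.congr_fun h p
  refine groupRing_hom_ext fun x => ?_
  simp only [LinearMap.comp_apply, LinearMap.mulRight_apply, mul_sub, mul_one, ← map_mul, map_sub,
    extend_of]

theorem extend_smul {A : Type*} [Ring A] [Module A V] (e : G →* A) (v : V)
    (p : MonoidAlgebra ℤ G) : extend (fun y => e y • v) p = lift ℤ A G e p • v := by
  suffices h : extend (fun y => e y • v) =
      (LinearMap.toSpanSingleton A V v).restrictScalars ℤ ∘ₗ (lift ℤ A G e).toLinearMap from
    LinearMap.congr_fun h p
  refine groupRing_hom_ext fun x => ?_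
  simp only [extend_of, LinearMap.comp_apply, LinearMap.restrictScalars_apply,
    LinearMap.toSpanSingleton_apply, AlgHom.toLinearMap_apply, MonoidAlgebra.lift_of]

theorem IsCrossedHom.extend_mul_of_sub_one {A : Type*} [Ring A] [Module A V] {e : G →* A}
    {d : G → V} (hd : IsCrossedHom e d) (p : MonoidAlgebra ℤ G) (a : G) :
    extend d (p * (of ℤ G a - 1)) = lift ℤ A G e p • d a := by
  simp only [_root_.extend_mul_of_sub_one, hd _ a, add_sub_cancel_left, extend_smul]

variable {σ : Type*} [Fintype σ]

/-- `p` is the family of coefficients of an expansion of `x - 1` in the left ideal of the group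
ring generated by the elements `a j - 1`. If the `a j` form a basis, these are the Fox derivatives
of `x`. -/
def IsFoxExpansion (a : σ → G) (x : G) (p : σ → MonoidAlgebra ℤ G) : Prop :=
  ∑ j, p j * (of ℤ G (a j) - 1) = of ℤ G x - 1

theorem exists_isFoxExpansion (R : Subring (MonoidAlgebra ℤ G)) {a : σ → G}
    (hR : ∀ x ∈ Subgroup.closure (Set.range a), of ℤ G x ∈ R) {x : G}
    (hx : x ∈ Subgroup.closure (Set.range a)) :
    ∃ p, IsFoxExpansion a x p ∧ ∀ j, p j ∈ R := by
  let I := Submodule.span R (Set.range fun j => of ℤ G (a j) - 1)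
  suffices h : of ℤ G x - 1 ∈ I by
    obtain ⟨p, hp⟩ := (Submodule.mem_span_range_iff_exists_fun R).1 h
    exact ⟨fun j => p j, hp, fun j => (p j).2⟩
  induction hx using Subgroup.closure_induction with
  | mem x hx =>
    obtain ⟨j, rfl⟩ := hx
    exact Submodule.subset_span ⟨j, rfl⟩
  | one => rw [map_one, sub_self]; exact I.zero_mem
  | mul x y hx _ ihx ihy =>
    have h := I.add_mem (I.smul_mem ⟨_, hR x hx⟩ ihy) ihx
    rwa [Subring.smul_def, smul_eq_mul, mul_sub, mul_one, ← map_mul, sub_add_sub_cancel] at h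
  | inv x hx ih =>
    have h := I.neg_mem (I.smul_mem ⟨_, hR x⁻¹ (inv_mem hx)⟩ ih)
    rwa [Subring.smul_def, smul_eq_mul, mul_sub, mul_one, ← map_mul, inv_mul_cancel, map_one,
      neg_sub] at h

namespace IsFoxExpansion

variable {a : σ → G} {x : G} {p : σ → MonoidAlgebra ℤ G}

theorem sum_extend_eq (hp : IsFoxExpansion a x p) (g : G → V) :
    ∑ j, extend g (p j * (of ℤ G (a j) - 1)) = g x - g 1 := by
  rw [← map_sum, hp, map_sub, extend_of, ← map_one (of ℤ G), extend_of]

/-- The fundamental formula of the Fox calculus. -/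
theorem apply_eq_sum {A : Type*} [Ring A] [Module A V] {e : G →* A} {d : G → V}
    (hp : IsFoxExpansion a x p) (hd : IsCrossedHom e d) :
    d x = ∑ j, lift ℤ A G e (p j) • d (a j) := by
  simp only [← hd.extend_mul_of_sub_one, hp.sum_extend_eq, hd.map_one, sub_zero]

end IsFoxExpansion

end GroupRing

section LinearDependence

open MonoidAlgebra (of lift)
open MalcevNeumann (supported proj)

variable {G : Type*} [Group G] [LinearOrder G] [MulLeftMono G] [MulRightMono G]

/-- The embedding of the group ring into the division ring of Mal'cev–Neumann series. -/
noncomputable def toSeries : MonoidAlgebra ℤ G →ₐ[ℤ] MalcevNeumann ℚ G :=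
  lift ℤ (MalcevNeumann ℚ G) G (MalcevNeumann.of ℚ)

theorem toSeries_of (x : G) : toSeries (of ℤ G x) = MalcevNeumann.of ℚ x :=
  MonoidAlgebra.lift_of ..

section Pairing

variable {ι V : Type*} [AddCommGroup V] [Module (MalcevNeumann ℚ G) V] {L : Subgroup G}

/-- The components of a group ring element along the right cosets of `L`, the component of
`l * t` being `l` if `l ∈ L` and `t` represents its coset. -/
noncomputable def cosetComponents (L : Subgroup G) :
    MonoidAlgebra ℤ G →ₗ[ℤ] RightCosets L →₀ MalcevNeumann ℚ G :=
  extend fun x => Finsupp.single (RightCosets.mk L x)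
    (MalcevNeumann.of ℚ (x * (RightCosets.mk L x).out⁻¹))

theorem cosetComponents_apply (p : MonoidAlgebra ℤ G) (t : RightCosets L) :
    cosetComponents L p t = proj L (toSeries p * MalcevNeumann.of ℚ t.out⁻¹) := by
  suffices h : Finsupp.lapply t ∘ₗ cosetComponents L =
      (proj L).toIntLinearMap ∘ₗ LinearMap.mulRight ℤ (MalcevNeumann.of ℚ t.out⁻¹) ∘ₗ
        toSeries.toLinearMap from LinearMap.congr_fun h p
  refine groupRing_hom_ext fun x => ?_
  simp only [cosetComponents, LinearMap.comp_apply, extend_of, Finsupp.lapply_apply,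
    AddMonoidHom.coe_toIntLinearMap, LinearMap.mulRight_apply, AlgHom.toLinearMap_apply,
    toSeries_of, ← map_mul]
  by_cases hxt : RightCosets.mk L x = t
  · subst hxt
    rw [Finsupp.single_eq_same, MalcevNeumann.proj_of_of_mem (RightCosets.mul_out_inv_mem x)]
  · rw [Finsupp.single_eq_of_ne' hxt, MalcevNeumann.proj_of_of_notMem fun hmem => hxt ?_]
    rw [← t.out_eq]
    exact (RightCosets.mk_eq_mk_iff.2 hmem).symm

theorem linearCombination_cosetComponents {g : G → V}
    (hg : ∀ l ∈ L, ∀ x, g (l * x) = MalcevNeumann.of ℚ l • g x) (p : MonoidAlgebra ℤ G) :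
    Finsupp.linearCombination (MalcevNeumann ℚ G) (fun t : RightCosets L => g t.out)
      (cosetComponents L p) = extend g p := by
  suffices h : (Finsupp.linearCombination (MalcevNeumann ℚ G)
      fun t : RightCosets L => g t.out).restrictScalars ℤ ∘ₗ cosetComponents L = extend g from
    LinearMap.congr_fun h p
  refine groupRing_hom_ext fun x => ?_
  simp only [cosetComponents, LinearMap.comp_apply, extend_of, LinearMap.restrictScalars_apply,
    Finsupp.linearCombination_single, ← hg _ (RightCosets.mul_out_inv_mem x),
    inv_mul_cancel_right]

theorem linearCombination_extend_eq_zero {u : ι →₀ MalcevNeumann ℚ G}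
    (hu : ∀ i, u i ∈ supported ℚ L) {p : ι → MonoidAlgebra ℤ G}
    (h : Finsupp.linearCombination (MalcevNeumann ℚ G) (fun i => toSeries (p i)) u = 0) {g : G → V}
    (hg : ∀ l ∈ L, ∀ x, g (l * x) = MalcevNeumann.of ℚ l • g x) :
    Finsupp.linearCombination (MalcevNeumann ℚ G) (fun i => extend g (p i)) u = 0 := by
  suffices hcomp : ∑ i ∈ u.support, u i • cosetComponents L (p i) = 0 by
    rw [Finsupp.linearCombination_apply, Finsupp.sum]
    simp only [← linearCombination_cosetComponents hg, ← map_smul, ← map_sum, hcomp, map_zero]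
  ext1 t
  rw [Finsupp.linearCombination_apply, Finsupp.sum] at h
  simp only [Finsupp.finsetSum_apply, Finsupp.smul_apply, cosetComponents_apply, smul_eq_mul,
    ← MalcevNeumann.proj_mul_left (hu _), ← map_sum, ← mul_assoc, ← Finset.sum_mul] at h ⊢
  rw [h, zero_mul, map_zero, Finsupp.zero_apply]

end Pairing

section Kernel

variable {ι : Type*} {S : Subgroup G}

theorem linearCombination_mapRange_proj_eq_zero {v : ι → MalcevNeumann ℚ G}
    (hv : ∀ i, v i ∈ supported ℚ S) {u : ι →₀ MalcevNeumann ℚ G}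
    (hu : Finsupp.linearCombination (MalcevNeumann ℚ G) v u = 0) :
    Finsupp.linearCombination (MalcevNeumann ℚ G) v (u.mapRange (proj S) (map_zero _)) = 0 := by
  rw [Finsupp.linearCombination_apply, Finsupp.sum_mapRange_index fun i => zero_smul _ (v i)]
  simpa only [Finsupp.linearCombination_apply, Finsupp.sum, smul_eq_mul, map_sum, map_zero,
    MalcevNeumann.proj_mul_right (hv _)] using congrArg (proj S) hu

theorem mem_supported_of_minimal {N : Submodule (MalcevNeumann ℚ G) (ι →₀ MalcevNeumann ℚ G)}
    (hN : ∀ u ∈ N, u.mapRange (proj S) (map_zero _) ∈ N) {n : ℕ}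
    (hmin : ∀ u ∈ N, u.support.card ≤ n → u = 0) {w : ι →₀ MalcevNeumann ℚ G} (hw : w ∈ N)
    (hcard : w.support.card ≤ n + 1) {i : ι} (hi : w i = 1) (j : ι) :
    w j ∈ supported ℚ S := by
  classical
  -- the difference of `w` and its truncation has smaller support, since it vanishes at `i`
  have hsupp : (w - w.mapRange (proj S) (map_zero _)).support ⊆ w.support.erase i := by
    intro k hk
    rw [Finsupp.mem_support_iff, Finsupp.sub_apply, Finsupp.mapRange_apply] at hk
    refine Finset.mem_erase.2 ⟨?_, Finsupp.mem_support_iff.2 ?_⟩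
    · rintro rfl
      rw [hi, MalcevNeumann.proj_one, sub_self] at hk
      exact hk rfl
    · intro h0
      rw [h0, map_zero, sub_self] at hk
      exact hk rfl
  have hle := Finset.card_le_card hsupp
  rw [Finset.card_erase_of_mem (by simp [hi])] at hle
  have h0 := hmin _ (N.sub_mem hw (hN w hw)) (by omega)
  exact MalcevNeumann.proj_eq_self_iff.1 (sub_eq_zero.1 (DFunLike.congr_fun h0 j)).symm

theorem eq_zero_of_forall_normalized {K : Type*} [DivisionRing K] {N : Submodule K (ι →₀ K)}
    {n : ℕ} (h : ∀ w ∈ N, w.support.card ≤ n → ∀ i, w i ≠ 1) {u : ι →₀ K} (hu : u ∈ N)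
    (hn : u.support.card ≤ n) : u = 0 := by
  by_contra hne
  obtain ⟨i, hi⟩ := Finsupp.ne_iff.1 hne
  refine h ((u i)⁻¹ • u) (N.smul_mem _ hu) ?_ i (inv_mul_cancel₀ hi)
  exact (Finset.card_le_card Finsupp.support_smul).trans hn

end Kernel

/-- The left kernel of the matrix of series with the rows `p i`. -/
noncomputable def relations {ι σ : Type*} (p : ι → σ → MonoidAlgebra ℤ G) :
    Submodule (MalcevNeumann ℚ G) (ι →₀ MalcevNeumann ℚ G) :=
  LinearMap.ker (Finsupp.linearCombination (MalcevNeumann ℚ G) fun i j => toSeries (p i j))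

theorem mem_relations {ι σ : Type*} {p : ι → σ → MonoidAlgebra ℤ G} {u : ι →₀ MalcevNeumann ℚ G} :
    u ∈ relations p ↔
      ∀ j, Finsupp.linearCombination (MalcevNeumann ℚ G) (fun i => toSeries (p i j)) u = 0 := by
  simp only [relations, LinearMap.mem_ker, funext_iff, Finsupp.linearCombination_apply,
    Finsupp.sum, Finset.sum_apply, Pi.smul_apply, Pi.zero_apply]

theorem mapRange_proj_mem_relations {ι σ : Type*} {S : Subgroup G} {p : ι → σ → MonoidAlgebra ℤ G}
    (hp : ∀ i j, toSeries (p i j) ∈ supported ℚ S) {u : ι →₀ MalcevNeumann ℚ G}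
    (hu : u ∈ relations p) : u.mapRange (proj S) (map_zero _) ∈ relations p :=
  mem_relations.2 fun j =>
    linearCombination_mapRange_proj_eq_zero (fun i => hp i j) (mem_relations.1 hu j)

section FoxMatrix

variable {ι σ τ : Type*} [Fintype σ] [Fintype τ] {L : Subgroup G}
  {a : σ → G} {p : ι → σ → MonoidAlgebra ℤ G} {u : ι →₀ MalcevNeumann ℚ G}

theorem linearCombination_of_sub_one_eq_zero {x : ι → G} (hp : ∀ i, IsFoxExpansion a (x i) (p i))
    (hu : u ∈ relations p) :
    Finsupp.linearCombination (MalcevNeumann ℚ G)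
      (fun i => MalcevNeumann.of ℚ (x i) - 1) u = 0 := by
  have hx (i : ι) : MalcevNeumann.of ℚ (x i) - 1 =
      ∑ j, toSeries (p i j) * (MalcevNeumann.of ℚ (a j) - 1) := by
    simpa only [map_sum, map_sub, map_mul, map_one, toSeries_of] using
      (congrArg toSeries (hp i)).symm
  have h (j : σ) := mem_relations.1 hu j
  simp only [Finsupp.linearCombination_apply, Finsupp.sum, smul_eq_mul] at h ⊢
  simp only [hx, Finset.mul_sum, ← mul_assoc]
  rw [Finset.sum_comm]
  simp only [← Finset.sum_mul, h, zero_mul, Finset.sum_const_zero]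

theorem eq_zero_of_mem_relations_of_mem_supported (b : FreeGroupBasis ι L)
    (hp : ∀ i, IsFoxExpansion a (b i : G) (p i)) (hu : ∀ i, u i ∈ supported ℚ L)
    (h : u ∈ relations p) : u = 0 := by
  -- the derivation `d` of `L` dual to `b` extends to the function `d ∘ ρ` on `G`, whose differences
  -- `y ↦ d (ρ (y * g)) - d (ρ y)` commute with left multiplication by `L`
  obtain ⟨ρ, hρ, hρ1⟩ := exists_equivariant_retraction L
  obtain ⟨d, hd, hdb⟩ := exists_isCrossedHom_basis b ((MalcevNeumann.of ℚ).comp L.subtype)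
    fun i => (Finsupp.single i 1 : ι →₀ MalcevNeumann ℚ G)
  have hpair (j : σ) : Finsupp.linearCombination (MalcevNeumann ℚ G)
      (fun i => extend (fun y => d (ρ (y * a j)) - d (ρ y)) (p i j)) u = 0 := by
    refine linearCombination_extend_eq_zero hu (mem_relations.1 h j) fun l hl x => ?_
    lift l to L using hl
    rw [mul_assoc, hρ, hρ, hd, hd, add_sub_add_left_eq_sub, ← smul_sub]
    rfl
  have hsingle (i : ι) : ∑ j, extend (fun y => d (ρ (y * a j)) - d (ρ y)) (p i j) =
      Finsupp.single i 1 := by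
    have hρb : ρ (b i) = b i := by simpa [hρ1] using hρ (b i) 1
    simp only [← extend_mul_of_sub_one fun y => d (ρ y), (hp i).sum_extend_eq, hρb, hρ1,
      hd.map_one, hdb, sub_zero]
  calc u = Finsupp.linearCombination (MalcevNeumann ℚ G) (fun i => Finsupp.single i 1) u := by
        simp [Finsupp.linearCombination_apply]
    _ = ∑ j, Finsupp.linearCombination (MalcevNeumann ℚ G)
          (fun i => extend (fun y => d (ρ (y * a j)) - d (ρ y)) (p i j)) u := by
        simp only [← hsingle, Finsupp.linearCombination_apply, Finsupp.sum, Finset.smul_sum]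
        exact Finset.sum_comm
    _ = 0 := Finset.sum_eq_zero fun j _ => hpair j

theorem eq_zero_of_mem_relations_of_card_le_two (b : FreeGroupBasis ι L)
    (hp : ∀ i, IsFoxExpansion a (b i : G) (p i)) (hu : u ∈ relations p)
    (hcard : u.support.card ≤ 2) : u = 0 := by
  refine eq_zero_of_forall_normalized (fun w hw hcard i hi => ?_) hu hcard
  let v (i : ι) : MalcevNeumann ℚ G := MalcevNeumann.of ℚ (b i : G) - 1
  have hv (i : ι) : v i ∈ supported ℚ L :=
    sub_mem (MalcevNeumann.of_mem_supported (b i).2) (one_mem _)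
  have hv0 (i : ι) : v i ≠ 0 := fun h => by
    have hbi : b i = 1 := Subtype.ext <| MalcevNeumann.of_injective <|
      (sub_eq_zero.1 h).trans (map_one (MalcevNeumann.of ℚ)).symm
    have hrepr := congrArg b.repr hbi
    rw [FreeGroupBasis.repr_apply_coe, map_one] at hrepr
    exact FreeGroup.of_ne_one i hrepr
  have hmin : ∀ u ∈ LinearMap.ker (Finsupp.linearCombination (MalcevNeumann ℚ G) v),
      u.support.card ≤ 1 → u = 0 := by
    intro u hu hc
    have : Nonempty ι := ⟨i⟩
    obtain ⟨j, c, rfl⟩ := Finsupp.card_support_le_one'.1 hc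
    rw [LinearMap.mem_ker, Finsupp.linearCombination_single] at hu
    rw [(smul_eq_zero.1 hu).resolve_right (hv0 j), Finsupp.single_zero]
  have hwL := mem_supported_of_minimal (fun u => linearCombination_mapRange_proj_eq_zero hv) hmin
    (linearCombination_of_sub_one_eq_zero hp hw) hcard hi
  simp [eq_zero_of_mem_relations_of_mem_supported b hp hwL hw] at hi

theorem eq_zero_of_mem_relations_inf_of_card_le_three {H K : Subgroup G}
    (b : FreeGroupBasis ι (H ⊓ K : Subgroup G)) {c : τ → G} {q : ι → τ → MonoidAlgebra ℤ G}
    (hp : ∀ i, IsFoxExpansion a (b i : G) (p i)) (hpH : ∀ i j, toSeries (p i j) ∈ supported ℚ H)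
    (hq : ∀ i, IsFoxExpansion c (b i : G) (q i)) (hqK : ∀ i j, toSeries (q i j) ∈ supported ℚ K)
    (hup : u ∈ relations p) (huq : u ∈ relations q) (hcard : u.support.card ≤ 3) : u = 0 := by
  refine eq_zero_of_forall_normalized (fun w hw hcard i hi => ?_)
    (Submodule.mem_inf.2 ⟨hup, huq⟩) hcard
  have hwH := mem_supported_of_minimal (fun u => mapRange_proj_mem_relations hpH)
    (fun u => eq_zero_of_mem_relations_of_card_le_two b hp) hw.1 hcard hi
  have hwK := mem_supported_of_minimal (fun u => mapRange_proj_mem_relations hqK)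
    (fun u => eq_zero_of_mem_relations_of_card_le_two b hq) hw.2 hcard hi
  have hw0 := eq_zero_of_mem_relations_of_mem_supported b hp
    (fun j => MalcevNeumann.mem_supported_inf (hwH j) (hwK j)) hw.1
  simp [hw0] at hi

end FoxMatrix

end LinearDependence

section RankInequality

open MonoidAlgebra (lift)

theorem card_add_card_le_of_surjective {K ι κ ρ : Type*} [DivisionRing K] [Fintype ρ]
    {φ : (ρ → K) →ₗ[K] κ →₀ K} (hφ : Function.Surjective φ) {v : ι → ρ → K}
    (hv : ∀ i, φ (v i) = 0) {s : Finset ι} (hs : LinearIndepOn K v (s : Set ι)) :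
    Finite κ ∧ s.card + Nat.card κ ≤ Fintype.card ρ := by
  have : Module.Finite K (κ →₀ K) := Module.Finite.of_surjective φ hφ
  have hκ : Finite κ := Module.Finite.finite_basis (Finsupp.basisSingleOne (R := K) (ι := κ))
  refine ⟨hκ, ?_⟩
  have := Fintype.ofFinite κ
  have hker : LinearIndependent K fun i : s => (⟨v i, hv i⟩ : LinearMap.ker φ) :=
    LinearIndependent.of_comp (LinearMap.ker φ).subtype hs
  have hle := hker.fintype_card_le_finrank
  have hrank := φ.finrank_range_add_finrank_ker
  rw [LinearMap.range_eq_top.2 hφ, finrank_top, Module.finrank_finsupp_self,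
    Module.finrank_fintype_fun_eq_card] at hrank
  rw [Fintype.card_coe] at hle
  rw [Nat.card_eq_fintype_card]
  omega

theorem IsCrossedHom.linearCombination_surjective {G A κ ρ : Type*} [Group G] [Ring A] [Fintype ρ]
    {e : G →* A} {d : G → κ →₀ A} (hd : IsCrossedHom e d)
    (hbasis : ∀ i, ∃ x, d x = Finsupp.single i 1) {f : ρ → G}
    (hf : Subgroup.closure (Set.range f) = ⊤) :
    Function.Surjective (Fintype.linearCombination A (d ∘ f)) := by
  have hmem (x : G) : d x ∈ LinearMap.range (Fintype.linearCombination A (d ∘ f)) := by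
    obtain ⟨p, hp, -⟩ := exists_isFoxExpansion ⊤ (fun _ _ => Subring.mem_top _)
      (hf ▸ Subgroup.mem_top x)
    exact ⟨fun j => lift ℤ A G e (p j), (hp.apply_eq_sum hd).symm⟩
  refine LinearMap.range_eq_top.1 (eq_top_iff.2 fun v _ => ?_)
  rw [← v.sum_single]
  refine Submodule.sum_mem _ fun i _ => ?_
  obtain ⟨x, hx⟩ := hbasis i
  rw [← mul_one (v i), ← smul_eq_mul, ← Finsupp.smul_single, ← hx]
  exact Submodule.smul_mem _ _ (hmem x)

section Biordered

variable {G : Type*} [Group G] [LinearOrder G] [MulLeftMono G] [MulRightMono G]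

theorem exists_isFoxExpansion_supported {ι σ : Type*} [Fintype σ] {a : σ → G} {H : Subgroup G}
    (ha : Subgroup.closure (Set.range a) = H) {x : ι → G} (hx : ∀ i, x i ∈ H) :
    ∃ p : ι → σ → MonoidAlgebra ℤ G, (∀ i, IsFoxExpansion a (x i) (p i)) ∧
      ∀ i j, toSeries (p i j) ∈ MalcevNeumann.supported ℚ H := by
  subst ha
  have h (i : ι) := exists_isFoxExpansion
    ((MalcevNeumann.supported ℚ (Subgroup.closure (Set.range a))).comap
      (toSeries : MonoidAlgebra ℤ G →ₐ[ℤ] MalcevNeumann ℚ G).toRingHom)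
    (fun y hy => by
      change toSeries (MonoidAlgebra.of ℤ G y) ∈ MalcevNeumann.supported ℚ _
      rw [toSeries_of]
      exact MalcevNeumann.of_mem_supported hy) (hx i)
  choose p hp hpH using h
  exact ⟨p, hp, hpH⟩

variable {ι κ σ τ : Type*}

theorem linearIndepOn_sumElim_neg {p : ι → σ → MonoidAlgebra ℤ G} {q : ι → τ → MonoidAlgebra ℤ G}
    {s : Finset ι} (h : ∀ u : ι →₀ MalcevNeumann ℚ G, u ∈ relations p → u ∈ relations q →
      u.support.card ≤ s.card → u = 0) :
    LinearIndepOn (MalcevNeumann ℚ G)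
      (fun i => Sum.elim (fun j => toSeries (p i j)) fun j => -toSeries (q i j)) (s : Set ι) := by
  rw [linearIndepOn_iff]
  intro u hus hu
  rw [Finsupp.mem_supported] at hus
  rw [Finsupp.linearCombination_apply, Finsupp.sum] at hu
  refine h u (mem_relations.2 fun j => ?_) (mem_relations.2 fun j => ?_)
    (Finset.card_le_card (Finset.coe_subset.1 hus))
  · simpa [Finsupp.linearCombination_apply, Finsupp.sum] using congrFun hu (Sum.inl j)
  · simpa [Finsupp.linearCombination_apply, Finsupp.sum] using congrFun hu (Sum.inr j)

theorem card_add_card_basis_le [Fintype σ] [Fintype τ] {a : σ → G} {c : τ → G} {H K : Subgroup G}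
    (b : FreeGroupBasis ι (H ⊓ K : Subgroup G)) (b' : FreeGroupBasis κ G)
    (ha : Subgroup.closure (Set.range a) = H) (hc : Subgroup.closure (Set.range c) = K)
    (hHK : H ⊔ K = ⊤) {s : Finset ι} (hs : s.card ≤ 3) :
    Finite κ ∧ s.card + Nat.card κ ≤ Fintype.card σ + Fintype.card τ := by
  obtain ⟨d, hd, hdb⟩ := exists_isCrossedHom_basis b' (MalcevNeumann.of ℚ)
    fun i => (Finsupp.single i 1 : κ →₀ MalcevNeumann ℚ G)
  obtain ⟨p, hp, hpH⟩ := exists_isFoxExpansion_supported ha fun i => (b i).2.1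
  obtain ⟨q, hq, hqK⟩ := exists_isFoxExpansion_supported hc fun i => (b i).2.2
  have hac : Subgroup.closure (Set.range (Sum.elim a c)) = ⊤ := by
    rw [Set.Sum.elim_range, Subgroup.closure_union, ha, hc, hHK]
  have hindep := linearIndepOn_sumElim_neg (s := s) fun u hup huq hu =>
    eq_zero_of_mem_relations_inf_of_card_le_three b hp hpH hq hqK hup huq (hu.trans hs)
  rw [← Fintype.card_sum]
  refine card_add_card_le_of_surjective
    (hd.linearCombination_surjective (fun i => ⟨b' i, hdb i⟩) hac) (fun i => ?_) hindep
  have hdp := (hp i).apply_eq_sum hd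
  have hdq := (hq i).apply_eq_sum hd
  simp only [Fintype.linearCombination_apply, Fintype.sum_sum_type, Sum.elim_inl, Sum.elim_inr,
    Function.comp_apply, neg_smul, Finset.sum_neg_distrib]
  exact add_neg_eq_zero.2 (hdp.symm.trans hdq)

end Biordered

theorem closure_range_basis {κ G : Type*} [Group G] (b : FreeGroupBasis κ G) :
    Subgroup.closure (Set.range b) = ⊤ := by
  have h := congrArg (Subgroup.map b.repr.symm.toMonoidHom) (FreeGroup.closure_range_of κ)
  rw [MonoidHom.map_closure, ← Set.range_comp,
    Subgroup.map_top_of_surjective _ b.repr.symm.surjective] at h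
  exact h

theorem exists_fg_rank_le_card_basis {κ G : Type*} [Group G] [Finite κ] (b : FreeGroupBasis κ G) :
    ∃ _ : Group.FG G, Group.rank G ≤ Nat.card κ := by
  classical
  have := Fintype.ofFinite κ
  have h : Subgroup.closure (Finset.univ.image b : Set G) = ⊤ := by
    simpa using closure_range_basis b
  have hfg : Group.FG G := ⟨⟨_, h⟩⟩
  refine ⟨hfg, (Group.rank_le h).trans ?_⟩
  exact Finset.card_image_le.trans_eq (Finset.card_univ.trans Fintype.card_eq_nat_card)

theorem exists_closure_range_eq {G : Type*} [Group G] (H : Subgroup G) [Group.FG H] :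
    ∃ a : Fin (Group.rank H) → G, Subgroup.closure (Set.range a) = H := by
  obtain ⟨S, hcard, hS⟩ := Group.rank_spec H
  let e : Fin (Group.rank H) ≃ S := (S.equivFinOfCardEq hcard).symm
  refine ⟨fun i => (e i : H), ?_⟩
  have hrange : Set.range (fun i => ((e i : H) : G)) = H.subtype '' S := by
    ext x
    constructor
    · rintro ⟨i, rfl⟩
      exact ⟨_, (e i).2, rfl⟩
    · rintro ⟨y, hy, rfl⟩
      exact ⟨e.symm ⟨y, hy⟩, by simp⟩
  rw [hrange, ← MonoidHom.map_closure, hS, ← MonoidHom.range_eq_map, H.range_subtype]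

instance fg_sup {G : Type*} [Group G] (H K : Subgroup G) [Group.FG H] [Group.FG K] :
    Group.FG ↥(H ⊔ K) :=
  (Group.fg_iff_subgroup_fg _).2 <|
    ((Group.fg_iff_subgroup_fg H).1 ‹_›).sup ((Group.fg_iff_subgroup_fg K).1 ‹_›)

theorem finite_and_card_le_of_forall_finset {ι : Type*} {m n : ℕ} (hnm : n < m)
    (h : ∀ s : Finset ι, s.card ≤ m → s.card ≤ n) : Finite ι ∧ Nat.card ι ≤ n := by
  have hne (s : Finset ι) : s.card ≠ m := fun hs => by
    have := h s hs.le
    omega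
  have hfin : Finite ι := by
    by_contra hinf
    have := not_finite_iff_infinite.1 hinf
    obtain ⟨s, hs⟩ := Infinite.exists_subset_card_eq ι m
    exact hne s hs
  have := Fintype.ofFinite ι
  rw [Nat.card_eq_fintype_card, ← Finset.card_univ]
  refine ⟨hfin, h _ (not_lt.1 fun hlt => ?_)⟩
  obtain ⟨s, -, hs⟩ := Finset.exists_subset_card_eq (s := Finset.univ) hlt.le
  exact hne s hs

theorem exists_fg_inf_rank_add_rank_le_of_sup_eq_top {G : Type*} [Group G] [IsFreeGroup G]
    [Group.FG G] {H K : Subgroup G} [Group.FG H] [Group.FG K] (hHK : H ⊔ K = ⊤)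
    (hrank : Group.rank H + Group.rank K ≤ Group.rank G + 2) :
    ∃ _ : Group.FG ↥(H ⊓ K),
      Group.rank ↥(H ⊓ K) + Group.rank G ≤ Group.rank H + Group.rank K := by
  obtain ⟨_, _, _⟩ := exists_biOrder_of_isFreeGroup G
  obtain ⟨a, ha⟩ := exists_closure_range_eq H
  obtain ⟨c, hc⟩ := exists_closure_range_eq K
  have key (s : Finset (IsFreeGroup.Generators ↥(H ⊓ K))) (hs : s.card ≤ 3) :
      s.card + Group.rank G ≤ Group.rank H + Group.rank K := by
    obtain ⟨_, h⟩ := card_add_card_basis_le (IsFreeGroup.basis ↥(H ⊓ K)) (IsFreeGroup.basis G)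
      ha hc hHK hs
    obtain ⟨_, hG⟩ := exists_fg_rank_le_card_basis (IsFreeGroup.basis G)
    simp only [Fintype.card_fin] at h
    omega
  obtain ⟨_, hcard⟩ := finite_and_card_le_of_forall_finset
    (n := Group.rank H + Group.rank K - Group.rank G) (m := 3) (by omega) fun s hs => by
      have := key s hs
      omega
  obtain ⟨hfg, hle⟩ := exists_fg_rank_le_card_basis (IsFreeGroup.basis ↥(H ⊓ K))
  have := key ∅ (by simp)
  exact ⟨hfg, by omega⟩

theorem theorem1p3_general {F : Type*} [Group F] [IsFreeGroup F] (H K : Subgroup F)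
    [Group.FG H] [Group.FG K]
    (hrank : Group.rank H + Group.rank K ≤ Group.rank ↥(H ⊔ K) + 2) :
    ∃ _ : Group.FG ↥(H ⊓ K),
      Group.rank ↥(H ⊓ K) + Group.rank ↥(H ⊔ K) ≤ Group.rank H + Group.rank K := by
  let eH := Subgroup.subgroupOfEquivOfLe (le_sup_left : H ≤ H ⊔ K)
  let eK := Subgroup.subgroupOfEquivOfLe (le_sup_right : K ≤ H ⊔ K)
  let eL : ↥(H.subgroupOf (H ⊔ K) ⊓ K.subgroupOf (H ⊔ K)) ≃* ↥(H ⊓ K) :=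
    Subgroup.subgroupOfEquivOfLe (inf_le_sup : H ⊓ K ≤ H ⊔ K)
  have : Group.FG (H.subgroupOf (H ⊔ K)) :=
    Group.fg_of_surjective (f := eH.symm.toMonoidHom) eH.symm.surjective
  have : Group.FG (K.subgroupOf (H ⊔ K)) :=
    Group.fg_of_surjective (f := eK.symm.toMonoidHom) eK.symm.surjective
  rw [← Group.rank_congr eH, ← Group.rank_congr eK] at hrank ⊢
  obtain ⟨_, hle⟩ := exists_fg_inf_rank_add_rank_le_of_sup_eq_top
    (by rw [← Subgroup.subgroupOf_sup le_sup_left le_sup_right, Subgroup.subgroupOf_self]) hrank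
  have hfg : Group.FG ↥(H ⊓ K) := Group.fg_of_surjective (f := eL.toMonoidHom) eL.surjective
  exact ⟨hfg, Group.rank_congr eL ▸ hle⟩

theorem rank_le_one_iff_isCyclic {G : Type*} [Group G] [Group.FG G] :
    Group.rank G ≤ 1 ↔ IsCyclic G := by
  constructor
  · intro h
    obtain ⟨S, hcard, hS⟩ := Group.rank_spec G
    obtain ⟨g, hg⟩ := Finset.card_le_one_iff_subset_singleton.1 (hcard.trans_le h)
    refine ⟨g, fun x => ?_⟩
    have hx := Subgroup.closure_mono (Finset.coe_subset.2 hg) (hS ▸ Subgroup.mem_top x)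
    rw [Finset.coe_singleton, ← Subgroup.zpowers_eq_closure] at hx
    exact hx
  · rintro ⟨g, hg⟩
    refine Group.rank_le (S := {g}) ?_
    rw [Finset.coe_singleton, ← Subgroup.zpowers_eq_closure]
    exact (Subgroup.eq_top_iff' _).2 hg

theorem two_le_rank_of_le {G : Type*} [Group G] {H J : Subgroup G} [Group.FG H] [Group.FG J]
    (hHJ : H ≤ J) (hH : 2 ≤ Group.rank H) : 2 ≤ Group.rank J := by
  by_contra! hJ
  have := rank_le_one_iff_isCyclic.1 (Nat.le_of_lt_succ hJ)
  have := isCyclic_of_injective (Subgroup.inclusion hHJ) (Subgroup.inclusion_injective hHJ)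
  have := rank_le_one_iff_isCyclic.2 this
  omega

end RankInequality

theorem theorem1p3 {F : Type*} [Group F] [IsFreeGroup F] (H K : Subgroup F)
    [Group.FG H] [Group.FG K] (hH : Group.rank H = 2) (hK : Group.rank K = 2) :
    ∃ (_ : Group.FG ↥(H ⊓ K)) (_ : Group.FG ↥(H ⊔ K)),
      (Group.rank ↥(H ⊓ K) : ℤ) ≤ 4 - (Group.rank ↥(H ⊔ K) : ℤ) ∧
      (Group.rank ↥(H ⊓ K) = 2 → Group.rank ↥(H ⊔ K) = 2) := by
  have hJ := two_le_rank_of_le (le_sup_left : H ≤ H ⊔ K) hH.ge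
  obtain ⟨hfg, hle⟩ := theorem1p3_general H K (by omega)
  exact ⟨hfg, inferInstance, by omega, by omega⟩
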